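/- Let $N\ge 2$ and let $a:(0,\infty)\to[0,\infty)$ be a $C^1$ function. Put $A(t)=\int_0^{|t|}a(s)s\,ds$ for $t\in\mathbb R$, and assume ($a_1$) $(a(t)t)'>0$ for all $t>0$; ($a_2$) there exist $l,m\in(1,N)$ with $l\le m<l^*:=\frac{lN}{N-l}$ and $l\le \dfrac{a(|t|)t^2}{A(t)}\le m$ for all $t\neq 0$. Let $L_A(\mathbb R^N)$ be the space of measurable $u$ with $\int_{\mathbb R^N}A(|u|)\,dx<\infty$, with the Luxemburg norm $\|u\|_A=\inf\{\alpha>0:\int_{\mathbb R^N}A(|u|/\alpha)\,dx\le 1\}$, and let $W^1L_A(\mathbb R^N)$ be the completion of $C_c^\infty(\mathbb R^N)$ in the norm $\|\nabla u\|_A+\|u\|_A$. That is, $v\in W^1L_A(\mathbb R^N)$ with gradient $\nabla v$ means that $v$ and $\nabla v$ belong to $L_A$ and that there are $\varphi_n\in C_c^\infty(\mathbb R^N)$ with $\|\nabla\varphi_n-\nabla v\|_A+\|\varphi_n-v\|_A\to0$. Then there is a constant $C>0$ such that every radial $v\in W^1L_A(\mathbb R^N)$ (i.e. $v(x)=w(|x|)$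 for a.e. $x$, for some function $w$) satisfies $$ |v(x)|\le A^{-1}\left(\frac{C}{|x|^{N-1}}\int_{\mathbb R^N}\bigl[A(|v|)+A(|\nabla v|)\bigr]\,dy\right)\quad\text{for a.e. }x\in\mathbb R^N, $$ where $A^{-1}$ is the inverse of the restriction of $A$ to $[0,\infty)$. The constant $C$ does not depend on $v$. -/

import Mathlib

open MeasureTheory Filter Topology
open scoped ContDiff ENNReal

noncomputable section

/-- The function `A(t) = ∫₀^{|t|} a(s) s ds`. -/
def orliczA (a : ℝ → ℝ) (t : ℝ) : ℝ :=
  ∫ s in (0 : ℝ)..|t|, a s * s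

/-- The inverse of the restriction of `A` to `[0, ∞)`. -/
def inverseOnNonneg (A : ℝ → ℝ) : ℝ → ℝ :=
  Function.invFunOn A (Set.Ici 0)

/-- The coefficient: `a` is nonnegative and `C¹` on `(0, ∞)`. The value of `a` at `0` plays no role,
and a singularity there is allowed (as for `A(t) = |t| ^ p` with `1 < p < 2`). -/
def IsCoefficient (a : ℝ → ℝ) : Prop :=
  (∀ t, 0 < t → 0 ≤ a t) ∧ ContDiffOn ℝ 1 a (Set.Ioi 0)

/-- Condition `(a₁)`: `(a(t) t)' > 0` for all `t > 0`. -/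
def ConditionA1 (a : ℝ → ℝ) : Prop :=
  ∀ t : ℝ, 0 < t → 0 < deriv (fun s => a s * s) t

/-- Condition `(a₂)`: there are `l, m ∈ (1, N)` with `l ≤ m < l* = l N / (N - l)` and
`l ≤ a(|t|) t² / A(t) ≤ m` for all `t ≠ 0`. -/
def ConditionA2 (N : ℕ) (a : ℝ → ℝ) : Prop :=
  ∃ l m : ℝ, 1 < l ∧ l < N ∧ 1 < m ∧ m < N ∧ l ≤ m ∧ m < l * N / (N - l) ∧
    ∀ t : ℝ, t ≠ 0 →
      l ≤ a |t| * t ^ 2 / orliczA a t ∧ a |t| * t ^ 2 / orliczA a t ≤ m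

section Spaces

variable {N : ℕ} {F : Type*} [NormedAddCommGroup F]

/-- Membership in the Orlicz space `L_A(ℝᴺ)`, for `A` satisfying the `Δ₂`-condition: `u` is
(Lebesgue) measurable and `∫ A(|u|) < ∞`. Vector-valued functions are measured by `|u|`. -/
def MemOrlicz (A : ℝ → ℝ) (u : EuclideanSpace ℝ (Fin N) → F) : Prop :=
  AEStronglyMeasurable u volume ∧ Integrable (fun x => A ‖u x‖) volume

/-- The Luxemburg norm `inf {α > 0 : ∫ A(|u| / α) ≤ 1}`, with values in `[0, ∞]`. -/
def luxemburgNorm (A : ℝ → ℝ) (u : EuclideanSpace ℝ (Fin N) → F) : ℝ≥0∞ :=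
  ⨅ (α : ℝ) (_ : 0 < α) (_ : ∫⁻ x, ENNReal.ofReal (A (‖u x‖ / α)) ≤ 1), ENNReal.ofReal α

/-- `v` belongs to `W¹L_A(ℝᴺ)` and `∇v = g`. The space is the completion of `C_c^∞(ℝᴺ)` for
`‖u‖ = ‖∇u‖_A + ‖u‖_A`, realised as a space of functions: the closure in `L_A × (L_A)ᴺ` of the
pairs `(φ, ∇φ)` with `φ ∈ C_c^∞(ℝᴺ)`. -/
structure MemW1LWithGradient (A : ℝ → ℝ) (v : EuclideanSpace ℝ (Fin N) → ℝ)
    (g : EuclideanSpace ℝ (Fin N) → EuclideanSpace ℝ (Fin N)) : Prop where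
  mem : MemOrlicz A v
  mem_gradient : MemOrlicz A g
  approx : ∃ φ : ℕ → EuclideanSpace ℝ (Fin N) → ℝ,
    (∀ n, ContDiff ℝ ∞ (φ n) ∧ HasCompactSupport (φ n)) ∧
    Tendsto (fun n => luxemburgNorm A (fun x => gradient (φ n) x - g x) +
      luxemburgNorm A (fun x => φ n x - v x)) atTop (𝓝 0)

/-- `v` is radial, as a function defined up to null sets: `v(x) = w(|x|)` for some `w`. -/
def IsRadialAE (v : EuclideanSpace ℝ (Fin N) → ℝ) : Prop :=
  ∃ w : ℝ → ℝ, ∀ᵐ x, v x = w ‖x‖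

end Spaces

end

/-! For `φ ∈ C_c^∞` and a unit vector `θ`, integrate the derivative of `A(φ(sθ))` inward from beyond
the support. Since `|A'(φ)| |∇φ| ≤ m (A(φ) + A(|∇φ|))`, this bounds `A(φ(rθ))` by an integral over
`s > r`. The weight `(s/r)^(N-1) ≥ 1` and integration over `θ` turn it into a bound of the integral
of `A(|φ|)` over directions by `m / r^(N-1)` times the full modular
(`IsDoublingYoung.lintegral_sphere_le`).

The approximants `φ n` of `v` need not be radial, so the limit is taken in this spherical integral,
not pointwise. Norm convergence gives modular convergence, Fatou's lemma in polar coordinates gives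
convergence along a subsequence on almost every sphere, and doubling replaces the triangle
inequality. Only then is radiality used: on almost every sphere `v` is a.e. the constant `w r`
(`IsDoublingYoung.ae_radial_bound`). Inverting `A` finishes the proof. -/

noncomputable section

/-- The properties of an even Young function satisfying the `Δ₂`-condition that the radial
estimate uses. The last field is a form of Young's inequality for `A'(t) u`. -/
structure IsDoublingYoung (A : ℝ → ℝ) (K m : ℝ) : Prop where
  apply_zero : A 0 = 0
  apply_abs : ∀ t, A |t| = A t
  strictMonoOn : StrictMonoOn A (Set.Ici 0)
  apply_add_le : ∀ s t, 0 ≤ s → 0 ≤ t → A (s + t) ≤ K * (A s + A t)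
  apply_mul_le : ∀ c t, 0 ≤ c → c ≤ 1 → 0 ≤ t → A (c * t) ≤ c * A t
  exists_hasDerivAt : ∀ t, ∃ d, HasDerivAt A d t ∧ ∀ u, 0 ≤ u → |d| * u ≤ m * (A t + A u)

theorem orliczA_abs (a : ℝ → ℝ) (t : ℝ) : orliczA a |t| = orliczA a t := by
  simp [orliczA]

theorem orliczA_zero (a : ℝ → ℝ) : orliczA a 0 = 0 := by
  simp [orliczA]

/-! ### Young function properties from `(a₁)` and `(a₂)`. -/

section Coefficient

variable {a : ℝ → ℝ}

theorem IsCoefficient.strictMonoOn (ha : IsCoefficient a) (ha1 : ConditionA1 a) :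
    StrictMonoOn (fun s => a s * s) (Set.Ioi 0) := by
  refine strictMonoOn_of_deriv_pos (convex_Ioi 0)
    (ha.2.continuousOn.mul continuousOn_id) fun x hx => ?_
  rw [interior_Ioi] at hx
  exact ha1 x hx

theorem IsCoefficient.pos (ha : IsCoefficient a) (ha1 : ConditionA1 a) {t : ℝ} (ht : 0 < t) :
    0 < a t * t := by
  have h := ha.strictMonoOn ha1 (half_pos ht) ht (half_lt_self ht)
  have := mul_nonneg (ha.1 _ (half_pos ht)) (half_pos ht).le
  exact this.trans_lt h

theorem IsCoefficient.monotoneOn (ha : IsCoefficient a) (ha1 : ConditionA1 a) :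
    MonotoneOn (fun s => a s * s) (Set.Ici 0) := by
  intro s hs t ht hst
  rcases eq_or_lt_of_le (Set.mem_Ici.1 hs) with rfl | hs'
  · rcases eq_or_lt_of_le (Set.mem_Ici.1 ht) with rfl | ht'
    · exact le_rfl
    · simpa using (ha.pos ha1 ht').le
  · exact (ha.strictMonoOn ha1).monotoneOn hs' (hs'.trans_le hst) hst

theorem IsCoefficient.hasDerivAt (ha : IsCoefficient a) (ha1 : ConditionA1 a) {t : ℝ}
    (ht : 0 < t) : HasDerivAt (orliczA a) (a t * t) t := by
  have hint : IntervalIntegrable (fun s => a s * s) volume 0 t :=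
    ((ha.monotoneOn ha1).mono (by
      rw [Set.uIcc_of_le ht.le]; exact Set.Icc_subset_Ici_self)).intervalIntegrable
  have hcont : ContinuousOn (fun s => a s * s) (Set.Ioi 0) :=
    ha.2.continuousOn.mul continuousOn_id
  have h := intervalIntegral.integral_hasDerivAt_right hint
    (hcont.stronglyMeasurableAtFilter isOpen_Ioi t ht)
    (hcont.continuousAt (Ioi_mem_nhds ht))
  refine h.congr_of_eventuallyEq ?_
  filter_upwards [Ioi_mem_nhds ht] with s hs
  simp [orliczA, abs_of_pos (Set.mem_Ioi.1 hs)]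

variable {N : ℕ} {l m : ℝ}

/-- If `A(t) ≤ 0`, the quotient in `(a₂)` would be nonpositive (it is `0` by convention when `A(t) =
0`), against `l > 0`. -/
theorem ConditionA2.pos_and_bounds (ha : IsCoefficient a) (ha1 : ConditionA1 a) (hl : 0 < l)
    (h2 : ∀ t : ℝ, t ≠ 0 →
      l ≤ a |t| * t ^ 2 / orliczA a t ∧ a |t| * t ^ 2 / orliczA a t ≤ m) {t : ℝ} (ht : 0 < t) :
    0 < orliczA a t ∧ l * orliczA a t ≤ a t * t * t ∧ a t * t * t ≤ m * orliczA a t := by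
  obtain ⟨h, h'⟩ := h2 t ht.ne'
  rw [abs_of_pos ht, sq, ← mul_assoc] at h h'
  have hA : 0 < orliczA a t := by
    by_contra hA
    have := div_nonpos_of_nonneg_of_nonpos (mul_pos (ha.pos ha1 ht) ht).le (not_lt.1 hA)
    linarith
  exact ⟨hA, (le_div_iff₀ hA).1 h, (div_le_iff₀ hA).1 h'⟩

theorem hasDerivAt_mul_rpow_neg {A : ℝ → ℝ} {d t : ℝ} (p : ℝ) (ht : 0 < t)
    (hA : HasDerivAt A d t) :
    HasDerivAt (fun s => A s * s ^ (-p)) ((d * t - p * A t) * t ^ (-p - 1)) t := by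
  refine (hA.mul (Real.hasDerivAt_rpow_const (p := -p) (Or.inl ht.ne'))).congr_deriv ?_
  rw [Real.rpow_sub_one ht.ne']
  field_simp
  ring

/-- The derivative of `A(t) t^(-p)` has the sign of `A'(t) t - p A(t)`. With `p = l` this yields
`A(ct) ≤ c^l A(t)` for `c ≤ 1`; the antitone version with `p = m` yields doubling. -/
theorem monotoneOn_mul_rpow_neg {A b : ℝ → ℝ} {p : ℝ} (hA : ∀ t, 0 < t → HasDerivAt A (b t) t)
    (h : ∀ t, 0 < t → p * A t ≤ b t * t) :
    MonotoneOn (fun s => A s * s ^ (-p)) (Set.Ioi 0) := by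
  refine monotoneOn_of_deriv_nonneg (convex_Ioi 0)
    (fun t ht => (hasDerivAt_mul_rpow_neg p ht (hA t ht)).continuousAt.continuousWithinAt) ?_ ?_
  all_goals
    intro t ht
    rw [interior_Ioi] at ht
    have hd := hasDerivAt_mul_rpow_neg p ht (hA t ht)
  · exact hd.differentiableAt.differentiableWithinAt
  · rw [hd.deriv]
    exact mul_nonneg (sub_nonneg.2 (h t ht)) (Real.rpow_nonneg (le_of_lt ht) _)

theorem antitoneOn_mul_rpow_neg {A b : ℝ → ℝ} {p : ℝ} (hA : ∀ t, 0 < t → HasDerivAt A (b t) t)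
    (h : ∀ t, 0 < t → b t * t ≤ p * A t) :
    AntitoneOn (fun s => A s * s ^ (-p)) (Set.Ioi 0) := by
  have := monotoneOn_mul_rpow_neg (A := fun t => -A t) (b := fun t => -b t) (p := p)
    (fun t ht => (hA t ht).neg) (fun t ht => by linarith [h t ht])
  intro s hs t ht hst
  have := this hs ht hst
  simp only [neg_mul, neg_le_neg_iff] at this
  exact this

theorem apply_mul_le_rpow_mul {A : ℝ → ℝ} {p c t : ℝ}
    (h : MonotoneOn (fun s => A s * s ^ (-p)) (Set.Ioi 0)) (hc : 0 < c) (hc1 : c ≤ 1)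
    (ht : 0 < t) : A (c * t) ≤ c ^ p * A t := by
  have := h (mul_pos hc ht) ht (mul_le_of_le_one_left ht.le hc1)
  simp only at this
  rw [Real.rpow_neg (mul_pos hc ht).le, Real.rpow_neg ht.le, Real.mul_rpow hc.le ht.le,
    ← div_eq_mul_inv, ← div_eq_mul_inv, div_le_div_iff₀ (by positivity) (by positivity)] at this
  have hp : 0 < t ^ p := by positivity
  nlinarith

theorem apply_two_mul_le_rpow_mul {A : ℝ → ℝ} {p t : ℝ}
    (h : AntitoneOn (fun s => A s * s ^ (-p)) (Set.Ioi 0)) (ht : 0 < t) :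
    A (2 * t) ≤ 2 ^ p * A t := by
  have := h ht (show 0 < 2 * t by positivity) (by linarith : t ≤ 2 * t)
  simp only at this
  rw [Real.rpow_neg (by positivity), Real.rpow_neg ht.le, Real.mul_rpow (by norm_num) ht.le,
    ← div_eq_mul_inv, ← div_eq_mul_inv, div_le_div_iff₀ (by positivity) (by positivity)] at this
  have hp : 0 < t ^ p := by positivity
  nlinarith

/-- Differentiability at `0` needs its own argument because `a` may be singular there, and it is
needed because `φ` may vanish along a ray. -/
theorem hasDerivAt_zero_of_rpow_bound {A : ℝ → ℝ} {p : ℝ} (hp : 1 < p)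
    (h0 : A 0 = 0) (hA : ∀ t, |t| ≤ 1 → |A t| ≤ A 1 * |t| ^ p) : HasDerivAt A 0 0 := by
  rw [hasDerivAt_iff_isLittleO]
  simp only [h0, sub_zero, smul_zero]
  have h1 : A =O[𝓝 0] fun t : ℝ => |t| ^ p := by
    refine Asymptotics.IsBigO.of_bound (A 1) ?_
    filter_upwards [Metric.closedBall_mem_nhds (0 : ℝ) one_pos] with t ht
    have ht' : |t| ≤ 1 := by simpa using ht
    simpa [abs_of_nonneg (Real.rpow_nonneg (abs_nonneg t) p)] using hA t ht'
  refine h1.trans_isLittleO ?_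
  rw [Asymptotics.isLittleO_iff_tendsto' (by
    filter_upwards with t ht
    simp [ht, Real.zero_rpow (by linarith : p ≠ 0)])]
  rw [tendsto_zero_iff_norm_tendsto_zero]
  have hlim : Tendsto (fun t : ℝ => |t| ^ (p - 1)) (𝓝 0) (𝓝 0) := by
    have : ContinuousAt (fun t : ℝ => |t| ^ (p - 1)) 0 :=
      continuous_abs.continuousAt.rpow_const (Or.inr (by linarith))
    simpa [ContinuousAt, Real.zero_rpow (by linarith : p - 1 ≠ 0)] using this
  refine hlim.congr fun t => ?_
  rcases eq_or_ne t 0 with rfl | ht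
  · simp [Real.zero_rpow (by linarith : p - 1 ≠ 0)]
  · rw [Real.rpow_sub_one (abs_ne_zero.2 ht), norm_div, Real.norm_eq_abs, Real.norm_eq_abs,
      abs_of_nonneg (Real.rpow_nonneg (abs_nonneg t) p)]

theorem ConditionA2.isDoublingYoung (ha : IsCoefficient a) (ha1 : ConditionA1 a)
    (ha2 : ConditionA2 N a) :
    ∃ K m : ℝ, 0 < K ∧ 0 < m ∧ IsDoublingYoung (orliczA a) K m := by
  obtain ⟨l, m, hl, -, hm, -, -, -, h2⟩ := ha2
  have hb : ∀ {t : ℝ}, 0 < t → _ := ConditionA2.pos_and_bounds ha ha1 (by linarith) h2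
  have hd : ∀ t, 0 < t → HasDerivAt (orliczA a) (a t * t) t := fun t ht => ha.hasDerivAt ha1 ht
  have hup := monotoneOn_mul_rpow_neg hd fun t ht => (hb ht).2.1
  have hdown := antitoneOn_mul_rpow_neg hd fun t ht => (hb ht).2.2
  have hnn : ∀ t, 0 ≤ orliczA a t := fun t => by
    rcases eq_or_ne t 0 with rfl | ht
    · simp [orliczA_zero]
    · rw [← orliczA_abs]; exact (hb (abs_pos.2 ht)).1.le
  have hd0 : HasDerivAt (orliczA a) 0 0 := by
    refine hasDerivAt_zero_of_rpow_bound hl (orliczA_zero a) fun t ht => ?_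
    rw [abs_of_nonneg (hnn t), mul_comm]
    rcases eq_or_ne t 0 with rfl | ht0
    · simp [orliczA_zero, Real.zero_rpow (by linarith : l ≠ 0)]
    · simpa [orliczA_abs] using apply_mul_le_rpow_mul hup (abs_pos.2 ht0) ht one_pos
  -- As `A'` is nondecreasing, `A'(t) u ≤ A'(x) x ≤ m A(x)` with `x = max t u`.
  have hYoung : ∀ t, 0 < t → ∀ u, 0 ≤ u →
      |a t * t| * u ≤ m * (orliczA a t + orliczA a u) := by
    intro t ht u hu
    rw [abs_of_pos (ha.pos ha1 ht), mul_add]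
    have hmt := mul_nonneg (by linarith : 0 ≤ m) (hnn t)
    have hmu := mul_nonneg (by linarith : 0 ≤ m) (hnn u)
    rcases le_total u t with hut | htu
    · have := mul_le_mul_of_nonneg_left hut (ha.pos ha1 ht).le
      linarith [(hb ht).2.2]
    · have := mul_le_mul_of_nonneg_right
        (ha.monotoneOn ha1 (Set.mem_Ici.2 ht.le) (Set.mem_Ici.2 hu) htu) hu
      simp only at this
      linarith [(hb (ht.trans_le htu)).2.2]
  have hderiv : ∀ t, ∃ d, HasDerivAt (orliczA a) d t ∧
      ∀ u, 0 ≤ u → |d| * u ≤ m * (orliczA a t + orliczA a u) := by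
    intro t
    rcases lt_trichotomy t 0 with ht | rfl | ht
    · refine ⟨-(a (-t) * -t), ?_, fun u hu => ?_⟩
      · have h := (hd (-t) (neg_pos.2 ht)).comp t (hasDerivAt_neg t)
        have he : orliczA a ∘ Neg.neg = orliczA a := by
          funext s; simp [orliczA]
        rw [he] at h
        simpa using h
      · rw [abs_neg]
        simpa [orliczA] using hYoung (-t) (neg_pos.2 ht) u hu
    · refine ⟨0, hd0, fun u _ => ?_⟩
      simpa [orliczA_zero] using mul_nonneg (by linarith : 0 ≤ m) (hnn u)
    · exact ⟨_, hd t ht, hYoung t ht⟩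
  have hcont : Continuous (orliczA a) := continuous_iff_continuousAt.2 fun t =>
    (hderiv t).choose_spec.1.continuousAt
  have hstrict : StrictMonoOn (orliczA a) (Set.Ici 0) := by
    refine strictMonoOn_of_deriv_pos (convex_Ici 0) hcont.continuousOn fun t ht => ?_
    rw [interior_Ici] at ht
    rw [(hd t ht).deriv]
    exact ha.pos ha1 ht
  -- `K = 2^m` because `A(s + t) ≤ A(2 max(s, t))`.
  refine ⟨2 ^ m, m, by positivity, by linarith, orliczA_zero a, orliczA_abs a, hstrict,
    fun s t hs ht => ?_, fun c t hc hc1 ht => ?_, hderiv⟩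
  · wlog hst : s ≤ t generalizing s t
    · rw [add_comm, add_comm (orliczA a s)]
      exact this t s ht hs (le_of_not_ge hst)
    have hs' := mul_nonneg (by positivity : (0 : ℝ) ≤ 2 ^ m) (hnn s)
    rcases eq_or_lt_of_le ht with rfl | ht'
    · have : s = 0 := le_antisymm hst hs
      simp [this, orliczA_zero]
    · calc orliczA a (s + t) ≤ orliczA a (2 * t) :=
            hstrict.monotoneOn (add_nonneg hs ht) (mul_nonneg two_pos.le ht) (by linarith)
        _ ≤ 2 ^ m * orliczA a t := apply_two_mul_le_rpow_mul hdown ht'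
        _ ≤ _ := by linarith
  · rcases eq_or_lt_of_le ht with rfl | ht'
    · simp [orliczA_zero]
    rcases eq_or_lt_of_le hc with rfl | hc'
    · simp [orliczA_zero]
    refine (apply_mul_le_rpow_mul hup hc' hc1 ht').trans ?_
    refine mul_le_mul_of_nonneg_right ?_ (hnn t)
    simpa using Real.rpow_le_rpow_of_exponent_ge hc' hc1 hl.le

end Coefficient

/-! ### Inverting `A`, and the one-dimensional estimate. -/

namespace IsDoublingYoung

variable {A : ℝ → ℝ} {K m : ℝ}

theorem continuous (hA : IsDoublingYoung A K m) : Continuous A :=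
  continuous_iff_continuousAt.2 fun t => (hA.exists_hasDerivAt t).choose_spec.1.continuousAt

theorem nonneg (hA : IsDoublingYoung A K m) (t : ℝ) : 0 ≤ A t := by
  rw [← hA.apply_abs, ← hA.apply_zero]
  exact hA.strictMonoOn.monotoneOn (Set.mem_Ici.2 le_rfl) (Set.mem_Ici.2 (abs_nonneg t))
    (abs_nonneg t)

theorem apply_le_apply (hA : IsDoublingYoung A K m) {s t : ℝ} (hs : 0 ≤ s) (h : s ≤ t) :
    A s ≤ A t :=
  hA.strictMonoOn.monotoneOn hs (hs.trans h) h

theorem apply_norm_le {F : Type*} [NormedAddCommGroup F] (hA : IsDoublingYoung A K m)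
    (x y : F) : A ‖x‖ ≤ K * (A ‖y‖ + A ‖y - x‖) := by
  refine (hA.apply_le_apply (norm_nonneg _) ?_).trans
    (hA.apply_add_le _ _ (norm_nonneg y) (norm_nonneg (y - x)))
  have := norm_sub_le y (y - x)
  rwa [sub_sub_cancel] at this

theorem le_inverseOnNonneg (hA : IsDoublingYoung A K m) {t y : ℝ} (ht : 0 ≤ t) (h : A t ≤ y) :
    t ≤ inverseOnNonneg A y := by
  have h1 : 0 < A 1 := by
    have := hA.strictMonoOn (Set.mem_Ici.2 le_rfl) (Set.mem_Ici.2 zero_le_one) zero_lt_one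
    rwa [hA.apply_zero] at this
  have hy : 0 ≤ y := (hA.nonneg t).trans h
  -- `A(1) ≤ A(T) / T` gives `A(T) ≥ T A(1) ≥ y`, so `y` is a value of `A` and `invFunOn` is a true
  -- inverse there.
  set T := max 1 (y / A 1) with hT
  have hT1 : 1 ≤ T := le_max_left _ _
  have hyT : y ≤ A T := by
    have h2 := hA.apply_mul_le T⁻¹ T (by positivity) (inv_le_one_of_one_le₀ hT1) (by positivity)
    rw [inv_mul_cancel₀ (by positivity), ← div_eq_inv_mul, le_div_iff₀ (by positivity)] at h2
    have := (div_le_iff₀ h1).1 (le_max_right 1 (y / A 1))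
    linarith
  obtain ⟨s, hs, hsy⟩ := intermediate_value_Icc (by positivity : (0 : ℝ) ≤ T)
    hA.continuous.continuousOn ⟨hA.apply_zero.trans_le hy, hyT⟩
  have hex : ∃ s ∈ Set.Ici (0 : ℝ), A s = y := ⟨s, hs.1, hsy⟩
  have hmem : inverseOnNonneg A y ∈ Set.Ici 0 := Function.invFunOn_mem hex
  have heq : A (inverseOnNonneg A y) = y := Function.invFunOn_eq hex
  exact (hA.strictMonoOn.le_iff_le ht hmem).1 (h.trans_eq heq.symm)

/-- Pointwise control of `A ∘ f` by an integral of `A ∘ f` and `A ∘ g`, where `|f'| ≤ g`. -/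
theorem apply_le_integral (hA : IsDoublingYoung A K m) {f f' g : ℝ → ℝ} {r R : ℝ}
    (hrR : r ≤ R) (hf : ∀ s, HasDerivAt f (f' s) s) (hg : Continuous g)
    (hfg : ∀ s, |f' s| ≤ g s) (hR : f R = 0) :
    A (f r) ≤ ∫ s in r..R, m * (A (f s) + A (g s)) := by
  have hfc : Continuous f := continuous_iff_continuousAt.2 fun s => (hf s).continuousAt
  have hAc := hA.continuous
  have hF : Continuous fun s => m * (A (f s) + A (g s)) := by fun_prop
  -- `A(f(s))` plus the integral up to `s` is nondecreasing; comparing its values at `r` and `R` is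
  -- the claim.
  have hder : ∀ s, ∃ d, HasDerivAt
      (fun s => A (f s) + ∫ t in r..s, m * (A (f t) + A (g t))) d s ∧ 0 ≤ d := by
    intro s
    obtain ⟨d, hd, hdu⟩ := hA.exists_hasDerivAt (f s)
    refine ⟨_, (hd.comp s (hf s)).add (hF.integral_hasStrictDerivAt r s).hasDerivAt, ?_⟩
    have h1 := hdu (g s) ((abs_nonneg _).trans (hfg s))
    have h2 : |d * f' s| ≤ |d| * g s := by
      rw [abs_mul]; exact mul_le_mul_of_nonneg_left (hfg s) (abs_nonneg d)
    linarith [neg_abs_le (d * f' s)]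
  have hmono : Monotone fun s => A (f s) + ∫ t in r..s, m * (A (f t) + A (g t)) :=
    monotone_of_deriv_nonneg (fun s => (hder s).choose_spec.1.differentiableAt) fun s => by
      rw [(hder s).choose_spec.1.deriv]; exact (hder s).choose_spec.2
  simpa [hR, hA.apply_zero] using hmono hrR

end IsDoublingYoung
-- Polar coordinates and null sets.
section Polar

variable {E : Type*} [NormedAddCommGroup E] [NormedSpace ℝ E] [MeasurableSpace E] [BorelSpace E]
  [FiniteDimensional ℝ E] [Nontrivial E] (μ : Measure E) [μ.IsAddHaarMeasure]

theorem lintegral_eq_lintegral_polar {f : E → ℝ≥0∞} (hf : Measurable f) :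
    ∫⁻ x, f x ∂μ = ∫⁻ θ, ∫⁻ r, f (r.1 • θ.1)
      ∂(Measure.volumeIoiPow (Module.finrank ℝ E - 1)) ∂μ.toSphere := by
  have h := μ.measurePreserving_homeomorphUnitSphereProd.lintegral_comp_emb
    (Homeomorph.measurableEmbedding _)
    (fun p : Metric.sphere (0 : E) 1 × Set.Ioi (0 : ℝ) => f (p.2.1 • p.1.1))
  have h' := lintegral_subtype_comap (μ := μ) (measurableSet_singleton (0 : E)).compl f
  rw [restrict_compl_singleton] at h'
  rw [← h', ← lintegral_prod
    (fun p : Metric.sphere (0 : E) 1 × Set.Ioi (0 : ℝ) => f (p.2.1 • p.1.1)) (by fun_prop), ← h]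
  refine lintegral_congr fun x => ?_
  have : ‖(x : E)‖ ≠ 0 := norm_ne_zero_iff.2 x.2
  simp [this]

theorem lintegral_eq_lintegral_polar_symm {f : E → ℝ≥0∞} (hf : Measurable f) :
    ∫⁻ x, f x ∂μ = ∫⁻ r, ∫⁻ θ, f (r.1 • θ.1) ∂μ.toSphere
      ∂(Measure.volumeIoiPow (Module.finrank ℝ E - 1)) := by
  rw [lintegral_eq_lintegral_polar μ hf]
  exact lintegral_lintegral_swap
    (f := fun (θ : Metric.sphere (0 : E) 1) (r : Set.Ioi (0 : ℝ)) => f (r.1 • θ.1))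
    (hf.comp (by fun_prop)).aemeasurable

theorem ae_polar_of_ae {p : E → Prop} (h : ∀ᵐ x ∂μ, p x) :
    ∀ᵐ r ∂(Measure.volumeIoiPow (Module.finrank ℝ E - 1)), ∀ᵐ θ ∂μ.toSphere,
      p (r.1 • θ.1) := by
  -- The exceptional set need not be measurable; its measurable hull is null as well.
  set s := toMeasurable μ {x | ¬p x} with hs
  have hsm : MeasurableSet s := measurableSet_toMeasurable _ _
  have hs0 : ∫⁻ x, s.indicator 1 x ∂μ = 0 := by
    rw [lintegral_indicator_one hsm, hs, measure_toMeasurable]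
    exact h
  have hf : Measurable (s.indicator (1 : E → ℝ≥0∞)) := measurable_one.indicator hsm
  have hf2 : Measurable fun q : Set.Ioi (0 : ℝ) × Metric.sphere (0 : E) 1 =>
      s.indicator (1 : E → ℝ≥0∞) (q.1.1 • q.2.1) := hf.comp (by fun_prop)
  rw [lintegral_eq_lintegral_polar_symm μ hf, lintegral_eq_zero_iff hf2.lintegral_prod_right'] at hs0
  filter_upwards [hs0] with r hr
  simp only [Pi.zero_apply] at hr
  have hfr : Measurable fun θ : Metric.sphere (0 : E) 1 =>
      s.indicator (1 : E → ℝ≥0∞) (r.1 • θ.1) := hf.comp (by fun_prop)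
  rw [lintegral_eq_zero_iff hfr] at hr
  filter_upwards [hr] with θ hθ
  by_contra hp
  have : r.1 • θ.1 ∈ s := subset_toMeasurable _ _ hp
  simp [this] at hθ

theorem ae_norm_of_ae {p : ℝ → Prop}
    (h : ∀ᵐ r ∂(Measure.volumeIoiPow (Module.finrank ℝ E - 1)), p r.1) :
    ∀ᵐ x ∂μ, p ‖x‖ := by
  have h2 : ∀ᵐ q ∂(μ.toSphere.prod (Measure.volumeIoiPow (Module.finrank ℝ E - 1))),
      p q.2.1 := Measure.quasiMeasurePreserving_snd.ae h
  have h3 := μ.measurePreserving_homeomorphUnitSphereProd.quasiMeasurePreserving.ae h2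
  simp only [homeomorphUnitSphereProd_apply_snd_coe] at h3
  have hemb := MeasurableEmbedding.subtype_coe (measurableSet_singleton (0 : E)).compl
  have := (hemb.ae_map_iff (μ := μ.comap Subtype.val) (p := fun x => p ‖x‖)).2 h3
  rwa [hemb.map_comap, Subtype.range_coe, restrict_compl_singleton] at this

end Polar

/-! ### Norm and modular. -/

variable {A : ℝ → ℝ} {K m : ℝ} {N : ℕ}

/-- Passage from Luxemburg norm convergence to modular convergence, in quantitative form. -/
theorem IsDoublingYoung.lintegral_le_luxemburgNorm {F : Type*} [NormedAddCommGroup F]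
    (hA : IsDoublingYoung A K m) (u : EuclideanSpace ℝ (Fin N) → F)
    (hu : luxemburgNorm A u < 1) :
    ∫⁻ x, ENNReal.ofReal (A ‖u x‖) ≤ luxemburgNorm A u := by
  refine le_of_forall_gt_imp_ge_of_dense fun ε hε => ?_
  have h1 := lt_min hε hu
  -- An admissible `α ≤ 1` below `ε` suffices, since then `A(|u|) ≤ α A(|u| / α)`.
  conv at h1 => lhs; unfold luxemburgNorm
  simp only [iInf_lt_iff] at h1
  obtain ⟨α, hα, hint, hαε⟩ := h1
  have hα1 : α ≤ 1 := by
    have := (hαε.trans_le (min_le_right _ _)).le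
    rwa [ENNReal.ofReal_le_one] at this
  calc ∫⁻ x, ENNReal.ofReal (A ‖u x‖)
      ≤ ∫⁻ x, ENNReal.ofReal α * ENNReal.ofReal (A (‖u x‖ / α)) := by
        refine lintegral_mono fun x => ?_
        rw [← ENNReal.ofReal_mul hα.le]
        refine ENNReal.ofReal_le_ofReal ?_
        have := hA.apply_mul_le α (‖u x‖ / α) hα.le hα1 (by positivity)
        rwa [mul_div_cancel₀ _ hα.ne'] at this
    _ = ENNReal.ofReal α * ∫⁻ x, ENNReal.ofReal (A (‖u x‖ / α)) :=
        lintegral_const_mul' _ _ ENNReal.ofReal_ne_top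
    _ ≤ ENNReal.ofReal α := mul_le_of_le_one_right' hint
    _ ≤ ε := (hαε.trans_le (min_le_left _ _)).le

theorem IsDoublingYoung.tendsto_lintegral {F : Type*} [NormedAddCommGroup F]
    (hA : IsDoublingYoung A K m) {u : ℕ → EuclideanSpace ℝ (Fin N) → F}
    (hu : Tendsto (fun n => luxemburgNorm A (u n)) atTop (𝓝 0)) :
    Tendsto (fun n => ∫⁻ x, ENNReal.ofReal (A ‖u n x‖)) atTop (𝓝 0) := by
  refine tendsto_of_tendsto_of_tendsto_of_le_of_le' tendsto_const_nhds hu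
    (Eventually.of_forall fun _ => zero_le) ?_
  filter_upwards [hu.eventually_lt_const zero_lt_one] with n hn
  exact hA.lintegral_le_luxemburgNorm (u n) hn

/-- Triangle inequality for the modular, up to the doubling constant. -/
theorem IsDoublingYoung.lintegral_le {α F : Type*} [MeasurableSpace α] {μ : Measure α}
    [NormedAddCommGroup F] (hA : IsDoublingYoung A K m) (hK : 0 ≤ K) {u v : α → F}
    (hv : AEStronglyMeasurable v μ) :
    ∫⁻ x, ENNReal.ofReal (A ‖u x‖) ∂μ ≤ ENNReal.ofReal K *
      (∫⁻ x, ENNReal.ofReal (A ‖v x‖) ∂μ + ∫⁻ x, ENNReal.ofReal (A ‖v x - u x‖) ∂μ) := by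
  rw [← lintegral_add_left', ← lintegral_const_mul' _ _ ENNReal.ofReal_ne_top]
  · refine lintegral_mono fun x => ?_
    rw [← ENNReal.ofReal_add (hA.nonneg _) (hA.nonneg _), ← ENNReal.ofReal_mul hK]
    exact ENNReal.ofReal_le_ofReal (hA.apply_norm_le (u x) (v x))
  · exact (hA.continuous.measurable.comp_aemeasurable hv.norm.aemeasurable).ennreal_ofReal

/-! ### Estimates on rays and spheres for test functions. -/

theorem IsDoublingYoung.ofReal_apply_ray_le (hA : IsDoublingYoung A K m) (hm : 0 < m)
    {φ : EuclideanSpace ℝ (Fin N) → ℝ} (hφ : ContDiff ℝ ∞ φ) (hφc : HasCompactSupport φ)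
    (k : ℕ) (r : Set.Ioi (0 : ℝ)) {θ : EuclideanSpace ℝ (Fin N)} (hθ : ‖θ‖ = 1) :
    ENNReal.ofReal (A ‖φ (r.1 • θ)‖) ≤ ENNReal.ofReal (m / r.1 ^ k) *
      ∫⁻ s, ENNReal.ofReal (A ‖φ (s.1 • θ)‖ + A ‖gradient φ (s.1 • θ)‖)
        ∂(Measure.volumeIoiPow k) := by
  have hr : 0 < r.1 := r.2
  have hAc := hA.continuous
  have hφcont := hφ.continuous
  have hφd : Differentiable ℝ φ := hφ.differentiable (by simp)
  have hgc : Continuous (gradient φ) :=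
    (InnerProductSpace.toDual ℝ _).symm.continuous.comp (hφ.continuous_fderiv (by simp))
  obtain ⟨R, hRr, hR⟩ : ∃ R, r.1 ≤ R ∧ φ (R • θ) = 0 := by
    obtain ⟨R, hR⟩ := hφc.isCompact.isBounded.subset_closedBall (0 : EuclideanSpace ℝ (Fin N))
    refine ⟨max r.1 (R + 1), le_max_left _ _, image_eq_zero_of_notMem_tsupport fun hmem => ?_⟩
    have := hR hmem
    rw [mem_closedBall_zero_iff, norm_smul, hθ, mul_one, Real.norm_eq_abs] at this
    linarith [le_abs_self (max r.1 (R + 1)), le_max_right r.1 (R + 1)]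
  have hF : Continuous fun s : ℝ => A ‖φ (s • θ)‖ + A ‖gradient φ (s • θ)‖ := by fun_prop
  have hpos : ∀ s : ℝ, 0 ≤ A ‖φ (s • θ)‖ + A ‖gradient φ (s • θ)‖ := fun s =>
    add_nonneg (hA.nonneg _) (hA.nonneg _)
  have hray := hA.apply_le_integral (f := fun s : ℝ => φ (s • θ))
    (f' := fun s => fderiv ℝ φ (s • θ) θ) (g := fun s => ‖gradient φ (s • θ)‖) hRr
    (fun s => by
      have h1 : HasDerivAt (fun s : ℝ => s • θ) θ s := by
        simpa using (hasDerivAt_id s).smul_const θ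
      exact (hφd (s • θ)).hasFDerivAt.comp_hasDerivAt s h1)
    (by fun_prop)
    (fun s => by
      rw [← Real.norm_eq_abs, gradient, LinearIsometryEquiv.norm_map]
      simpa [hθ] using (fderiv ℝ φ (s • θ)).le_opNorm θ) hR
  simp only [← hA.apply_abs (φ _), ← Real.norm_eq_abs] at hray
  rw [intervalIntegral.integral_of_le hRr] at hray
  refine (ENNReal.ofReal_le_ofReal hray).trans ?_
  rw [ofReal_integral_eq_lintegral_ofReal
    (f := fun s => m * (A ‖φ (s • θ)‖ + A ‖gradient φ (s • θ)‖))
    ((continuous_const.mul hF).integrableOn_Ioc)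
    (Eventually.of_forall fun s => mul_nonneg hm.le (hpos s)),
    Measure.volumeIoiPow, lintegral_withDensity_eq_lintegral_mul _ (by fun_prop)
      (by fun_prop)]
  simp only [Pi.mul_apply]
  rw [lintegral_subtype_comap measurableSet_Ioi (fun s : ℝ => ENNReal.ofReal (s ^ k) *
      ENNReal.ofReal (A ‖φ (s • θ)‖ + A ‖gradient φ (s • θ)‖)),
    ← lintegral_const_mul' _ _ ENNReal.ofReal_ne_top]
  -- On `(r, R]` the weight `s^k / r^k` is at least `1`; afterwards the domain is enlarged to `(0,
  -- ∞)`.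
  refine (setLIntegral_mono' measurableSet_Ioc fun s hs => ?_).trans
    (lintegral_mono_set fun s hs => hr.trans hs.1)
  have hs0 : 0 < s := hr.trans hs.1
  rw [← ENNReal.ofReal_mul (by positivity), ← ENNReal.ofReal_mul (by positivity), ← mul_assoc]
  refine ENNReal.ofReal_le_ofReal (mul_le_mul_of_nonneg_right ?_ (hpos s))
  rw [div_mul_eq_mul_div, le_div_iff₀ (by positivity)]
  exact mul_le_mul_of_nonneg_left (pow_le_pow_left₀ hr.le hs.1.le k) hm.le

theorem IsDoublingYoung.lintegral_sphere_le [Nontrivial (EuclideanSpace ℝ (Fin N))]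
    (hA : IsDoublingYoung A K m) (hm : 0 < m)
    {φ : EuclideanSpace ℝ (Fin N) → ℝ} (hφ : ContDiff ℝ ∞ φ) (hφc : HasCompactSupport φ)
    (r : Set.Ioi (0 : ℝ)) :
    ∫⁻ θ, ENNReal.ofReal (A ‖φ (r.1 • θ.1)‖)
        ∂(volume : Measure (EuclideanSpace ℝ (Fin N))).toSphere ≤
      ENNReal.ofReal (m / r.1 ^ (N - 1)) *
        ((∫⁻ x, ENNReal.ofReal (A ‖φ x‖)) + ∫⁻ x, ENNReal.ofReal (A ‖gradient φ x‖)) := by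
  have hAc := hA.continuous
  have hφcont := hφ.continuous
  have hgc : Continuous (gradient φ) :=
    (InnerProductSpace.toDual ℝ _).symm.continuous.comp (hφ.continuous_fderiv (by simp))
  rw [← lintegral_add_left (by fun_prop)]
  simp only [← ENNReal.ofReal_add (hA.nonneg _) (hA.nonneg _)]
  rw [lintegral_eq_lintegral_polar volume (by fun_prop), finrank_euclideanSpace_fin,
    ← lintegral_const_mul' _ _ ENNReal.ofReal_ne_top]
  exact lintegral_mono fun θ =>
    hA.ofReal_apply_ray_le hm hφ hφc (N - 1) r (by simp)

/-! ### Passage to the limit. -/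

theorem ENNReal.le_of_tendsto_of_liminf_eq_zero {X c k : ℝ≥0∞} {c' h : ℕ → ℝ≥0∞} (hk : k ≠ ⊤)
    (hX : ∀ n, X ≤ c' n + k * h n) (hc : Tendsto c' atTop (𝓝 c)) (hh : liminf h atTop = 0) :
    X ≤ c := by
  rcases eq_or_ne c ⊤ with rfl | hctop
  · exact le_top
  have hlim : Tendsto (fun ε : ℝ≥0∞ => (c + ε) + k * ε) (𝓝[>] 0) (𝓝 c) := by
    have h1 : Tendsto (fun ε : ℝ≥0∞ => ε) (𝓝[>] 0) (𝓝 0) := nhdsWithin_le_nhds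
    simpa using (h1.const_add c).add (ENNReal.Tendsto.const_mul h1 (Or.inr hk))
  refine ge_of_tendsto hlim ?_
  filter_upwards [self_mem_nhdsWithin] with ε hε
  -- `h n` is small infinitely often and `c' n` is eventually near `c`, so some `n` serves both.
  have hfreq : ∃ᶠ n in atTop, h n < ε := frequently_lt_of_liminf_lt (by isBoundedDefault)
    (by rw [hh]; exact hε)
  obtain ⟨n, hn, hn'⟩ := (hfreq.and_eventually
    (hc.eventually_lt_const (ENNReal.lt_add_right hctop (ne_of_gt hε)))).exists
  exact (hX n).trans (by gcongr)

theorem IsDoublingYoung.ae_radial_bound {A : ℝ → ℝ} {K m : ℝ} {N : ℕ}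
    [Nontrivial (EuclideanSpace ℝ (Fin N))] (hA : IsDoublingYoung A K m) (hK : 0 < K) (hm : 0 < m)
    {v : EuclideanSpace ℝ (Fin N) → ℝ} {g : EuclideanSpace ℝ (Fin N) → EuclideanSpace ℝ (Fin N)}
    (hv : MemW1LWithGradient A v g) {w : ℝ → ℝ} (hw : ∀ᵐ x, v x = w ‖x‖) :
    ∀ᵐ r ∂(Measure.volumeIoiPow (N - 1)), ENNReal.ofReal (A ‖w r.1‖) *
        (volume : Measure (EuclideanSpace ℝ (Fin N))).toSphere Set.univ ≤
      ENNReal.ofReal K * (ENNReal.ofReal (m / r.1 ^ (N - 1)) * (ENNReal.ofReal K *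
        ((∫⁻ x, ENNReal.ofReal (A ‖v x‖)) + ∫⁻ x, ENNReal.ofReal (A ‖g x‖)))) := by
  obtain ⟨φ, hφ, hlim⟩ := hv.approx
  have hAc := hA.continuous
  set σ := (volume : Measure (EuclideanSpace ℝ (Fin N))).toSphere
  have hφc : ∀ n, Continuous (φ n) := fun n => (hφ n).1.continuous
  have hvm := hv.mem.1
  have hgm := hv.mem_gradient.1
  -- A measurable representative makes the spherical integrals `h n r` measurable in `r`.
  set u := hvm.mk v with hu
  have hum : Measurable u := hvm.stronglyMeasurable_mk.measurable
  have huv : v =ᵐ[volume] u := hvm.ae_eq_mk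
  have hδ : Tendsto (fun n => ∫⁻ x, ENNReal.ofReal (A ‖φ n x - v x‖)) atTop (𝓝 0) :=
    hA.tendsto_lintegral (tendsto_of_tendsto_of_tendsto_of_le_of_le tendsto_const_nhds hlim
      (fun _ => zero_le) fun _ => le_add_self)
  have hη : Tendsto (fun n => ∫⁻ x, ENNReal.ofReal (A ‖gradient (φ n) x - g x‖)) atTop (𝓝 0) :=
    hA.tendsto_lintegral (tendsto_of_tendsto_of_tendsto_of_le_of_le tendsto_const_nhds hlim
      (fun _ => zero_le) fun _ => le_self_add)
  set h : ℕ → Set.Ioi (0 : ℝ) → ℝ≥0∞ := fun n r =>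
    ∫⁻ θ, ENNReal.ofReal (A ‖φ n (r.1 • θ.1) - u (r.1 • θ.1)‖) ∂σ with hh
  have hmeas : ∀ n, Measurable fun x => ENNReal.ofReal (A ‖φ n x - u x‖) := fun n =>
    (hAc.measurable.comp ((hφc n).measurable.sub hum).norm).ennreal_ofReal
  have hhm : ∀ n, Measurable (h n) := fun n =>
    Measurable.lintegral_prod_right'
      (f := fun q : Set.Ioi (0 : ℝ) × Metric.sphere (0 : EuclideanSpace ℝ (Fin N)) 1 =>
        ENNReal.ofReal (A ‖φ n (q.1.1 • q.2.1) - u (q.1.1 • q.2.1)‖))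
      ((hmeas n).comp (by fun_prop))
  have hhint : ∀ n, ∫⁻ r, h n r ∂(Measure.volumeIoiPow (N - 1)) =
      ∫⁻ x, ENNReal.ofReal (A ‖φ n x - v x‖) := fun n => by
    have := lintegral_eq_lintegral_polar_symm volume (hmeas n)
    rw [finrank_euclideanSpace_fin] at this
    rw [hh, ← this]
    refine lintegral_congr_ae ?_
    filter_upwards [huv] with x hx
    rw [hx]
  have hliminfm : Measurable fun r => liminf (fun n => h n r) atTop := .liminf hhm
  -- Fatou: the integrals of `h n` over `r` tend to `0`. The vanishing liminf avoids choosing a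
  -- subsequence.
  have hliminf : ∀ᵐ r ∂(Measure.volumeIoiPow (N - 1)), liminf (fun n => h n r) atTop = 0 := by
    have hle : ∫⁻ r, liminf (fun n => h n r) atTop ∂(Measure.volumeIoiPow (N - 1)) ≤
        liminf (fun n => ∫⁻ r, h n r ∂(Measure.volumeIoiPow (N - 1))) atTop :=
      lintegral_liminf_le hhm
    simp only [hhint, hδ.liminf_eq] at hle
    exact (lintegral_eq_zero_iff hliminfm).1 (le_antisymm hle zero_le)
  have hsphere : ∀ᵐ r ∂(Measure.volumeIoiPow (N - 1)), ∀ᵐ θ ∂σ, u (r.1 • θ.1) = w r.1 := by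
    have huw : ∀ᵐ x, u x = w ‖x‖ := by
      filter_upwards [huv, hw] with x hx hx'
      rw [← hx, hx']
    have := ae_polar_of_ae volume huw
    rw [finrank_euclideanSpace_fin] at this
    filter_upwards [this] with r hr
    filter_upwards [hr] with θ hθ
    have hθ1 : ‖θ.1‖ = 1 := by simp
    rwa [norm_smul, hθ1, mul_one, Real.norm_eq_abs, abs_of_pos r.2] at hθ
  filter_upwards [hliminf, hsphere] with r hr1 hr2
  -- The outer `K` comes from replacing `u` by `φ n` on the sphere, the inner one from replacing `φ
  -- n` by `v`, and its gradient by `g`, on the whole space.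
  refine ENNReal.le_of_tendsto_of_liminf_eq_zero (k := ENNReal.ofReal K) (h := fun n => h n r)
    (c' := fun n => ENNReal.ofReal K * (ENNReal.ofReal (m / r.1 ^ (N - 1)) * (ENNReal.ofReal K *
      (((∫⁻ x, ENNReal.ofReal (A ‖v x‖)) + ∫⁻ x, ENNReal.ofReal (A ‖φ n x - v x‖)) +
        ((∫⁻ x, ENNReal.ofReal (A ‖g x‖)) +
          ∫⁻ x, ENNReal.ofReal (A ‖gradient (φ n) x - g x‖))))))
    ENNReal.ofReal_ne_top (fun n => ?_) ?_ hr1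
  · have h1 : ENNReal.ofReal (A ‖w r.1‖) * σ Set.univ =
        ∫⁻ θ, ENNReal.ofReal (A ‖u (r.1 • θ.1)‖) ∂σ := by
      rw [← lintegral_const]
      refine lintegral_congr_ae ?_
      filter_upwards [hr2] with θ hθ
      rw [hθ]
    have h2 := hA.lintegral_le (μ := σ) hK.le (u := fun θ => u (r.1 • θ.1))
      (v := fun θ => φ n (r.1 • θ.1))
      (Continuous.aestronglyMeasurable (by have := hφc n; fun_prop))
    have h3 := hA.lintegral_sphere_le hm (hφ n).1 (hφ n).2 r
    have h4 := hA.lintegral_le (μ := volume) hK.le (u := φ n) hvm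
    have h5 := hA.lintegral_le (μ := volume) hK.le (u := gradient (φ n)) hgm
    simp only [norm_sub_rev (v _), norm_sub_rev (g _)] at h4 h5
    rw [h1]
    refine h2.trans ?_
    rw [mul_add]
    gcongr
    refine h3.trans ?_
    rw [mul_add (ENNReal.ofReal K)]
    gcongr
  · have hsum := (hδ.const_add (∫⁻ x, ENNReal.ofReal (A ‖v x‖))).add
      (hη.const_add (∫⁻ x, ENNReal.ofReal (A ‖g x‖)))
    simp only [add_zero] at hsum
    exact ENNReal.Tendsto.const_mul (ENNReal.Tendsto.const_mul (ENNReal.Tendsto.const_mul hsum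
      (Or.inr ENNReal.ofReal_ne_top)) (Or.inr ENNReal.ofReal_ne_top))
      (Or.inr ENNReal.ofReal_ne_top)

end

theorem mainTheorem1 (N : ℕ) (hN : 2 ≤ N) (a : ℝ → ℝ) (ha : IsCoefficient a)
    (ha1 : ConditionA1 a) (ha2 : ConditionA2 N a) :
    ∃ C : ℝ, 0 < C ∧
      ∀ (v : EuclideanSpace ℝ (Fin N) → ℝ)
        (gradv : EuclideanSpace ℝ (Fin N) → EuclideanSpace ℝ (Fin N)),
        MemW1LWithGradient (orliczA a) v gradv → IsRadialAE v →
        ∀ᵐ x, |v x| ≤ inverseOnNonneg (orliczA a)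
          (C / ‖x‖ ^ (N - 1) * ∫ y, (orliczA a |v y| + orliczA a ‖gradv y‖)) := by
  obtain ⟨K, m, hK, hm, hA⟩ := ConditionA2.isDoublingYoung ha ha1 ha2
  have : Nontrivial (EuclideanSpace ℝ (Fin N)) :=
    Module.nontrivial_of_finrank_pos (R := ℝ) (by rw [finrank_euclideanSpace_fin]; omega)
  set σ := (volume : Measure (EuclideanSpace ℝ (Fin N))).toSphere with hσ
  have hσ0 : 0 < σ.real Set.univ := by
    have hne : σ ≠ 0 := Measure.toSphere_ne_zero volume
    exact ENNReal.toReal_pos (mt Measure.measure_univ_eq_zero.1 hne) (measure_ne_top σ _)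
  -- The division by the area of the unit sphere comes from integrating the constant `A(|w r|)` over
  -- directions.
  refine ⟨K * m * K / σ.real Set.univ, by positivity, fun v g hv ⟨w, hw⟩ => ?_⟩
  have hnonneg := hA.nonneg
  have hbound := hA.ae_radial_bound hK hm hv hw
  rw [← ofReal_integral_eq_lintegral_ofReal hv.mem.2 (Eventually.of_forall fun _ => hnonneg _),
    ← ofReal_integral_eq_lintegral_ofReal hv.mem_gradient.2
      (Eventually.of_forall fun _ => hnonneg _),
    ← ENNReal.ofReal_add (integral_nonneg fun _ => hnonneg _) (integral_nonneg fun _ => hnonneg _),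
    ← integral_add hv.mem.2 hv.mem_gradient.2] at hbound
  have hI : 0 ≤ ∫ y, (orliczA a ‖v y‖ + orliczA a ‖g y‖) :=
    integral_nonneg fun _ => add_nonneg (hnonneg _) (hnonneg _)
  have hae : ∀ᵐ r ∂(Measure.volumeIoiPow
      (Module.finrank ℝ (EuclideanSpace ℝ (Fin N)) - 1)),
      orliczA a ‖w r.1‖ ≤ K * m * K / σ.real Set.univ / r.1 ^ (N - 1) *
        ∫ y, (orliczA a ‖v y‖ + orliczA a ‖g y‖) := by
    rw [finrank_euclideanSpace_fin]
    filter_upwards [hbound] with r hr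
    have hr0 : 0 < r.1 := r.2
    rw [← hσ, ← ofReal_measureReal (measure_ne_top σ _), ← ENNReal.ofReal_mul (hnonneg _),
      ← ENNReal.ofReal_mul hK.le, ← ENNReal.ofReal_mul (by positivity),
      ← ENNReal.ofReal_mul hK.le, ENNReal.ofReal_le_ofReal_iff (by positivity),
      ← le_div_iff₀ hσ0] at hr
    refine hr.trans_eq ?_
    field_simp
  filter_upwards [ae_norm_of_ae volume (p := fun r => orliczA a ‖w r‖ ≤
    K * m * K / σ.real Set.univ / r ^ (N - 1) *
      ∫ y, (orliczA a ‖v y‖ + orliczA a ‖g y‖)) hae, hw] with x hx hxw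
  refine hA.le_inverseOnNonneg (abs_nonneg _) ?_
  simp only [Real.norm_eq_abs (w _), Real.norm_eq_abs (v _)] at hx
  rwa [hxw]
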